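/- Conventions. Manifolds are finite-dimensional, without boundary, Hausdorff and second countable, and carry their Borel $\sigma$-algebra $\mathsf B(\cdot)$; $\Delta(X)$ is the set of Borel probability measures on $X$. An MDP $\mathcal M=(\mathcal S,\mathcal A,R,\tau,\gamma)$ consists of smooth manifolds $\mathcal S$ (states) and $\mathcal A$ (actions), maps $R:\mathcal S\times\mathcal A\to\mathbb R$ and $\tau:\mathcal S\times\mathcal A\to\Delta(\mathcal S)$, and $\gamma\in[0,1)$. A policy is a map $\pi:\mathcal S\to\Delta(\mathcal A)$. A continuous MDP homomorphism from $\mathcal M$ to $\widetilde{\mathcal M}=(\widetilde{\mathcal S},\widetilde{\mathcal A},\widetilde R,\widetilde\tau,\gamma)$ is a pair $p:\mathcal S\to\widetilde{\mathcal S}$, $h:\mathcal S\times\mathcal A\to\widetilde{\mathcal A}$ such that $p$ and every $h_s=h(s,\cdot)$ are measurable and surjective, $R(s,a)=\widetilde R(p(s),h(s,a))$, and $\tau(p^{-1}(\widetilde B)\mid s,a)=\widetilde\tau(\widetilde B\mid p(s),h(s,a))$ for all $s,a$ and $\widetilde B\in\mathsf B(\widetilde{\mathcal S})$. A policy $\pi$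 for $\mathcal M$ is a lift of a policy $\widetilde\pi$ for $\widetilde{\mathcal M}$ if $\pi(h_s^{-1}(\widetilde A)\mid s)=\widetilde\pi(\widetilde A\mid p(s))$ for all $s\in\mathcal S$ and $\widetilde A\in\mathsf B(\widetilde{\mathcal A})$. A Lie group symmetry of $\mathcal M$ is a pair $(\Phi,\Psi)$ of smooth left actions of a Lie group $\mathcal G$ on $\mathcal S$ and $\mathcal A$ such that $R(s,a)=R(\Phi_g(s),\Psi_g(a))$ and $\tau(B\mid s,a)=\tau(B\mid\Phi_g(s),\Psi_g(a))$ for all $g,s,a$ and all $\Phi$-invariant $B\in\mathsf B(\mathcal S)$. Theorem. Let $\mathcal M$ be an MDP with a Lie group symmetry $(\Phi,\Psi)$. Suppose that $\Phi$ is free ($\Phi_g(s)=s$ implies $g=e$) and proper (preimages of compact sets under $(g,s)\mapsto(\Phi_g(s),s)$ are compact), and let $\lambda:\mathcal S\to\mathcal G$ be any map, not necessarily continuous, with $\lambda(\Phi_g(s))=g\,\lambda(s)$ for all $g,s$. Let $p:\mathcal S\to\mathcal S/\mathcal G$ send each state to its $\Phi$-orbit and let $h(s,a)=\Psi_{\lambda(s)^{-1}}(a)$.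 Then $\mathcal S/\mathcal G$ with the quotient topology is a smooth manifold, of dimension $\dim\mathcal S-\dim\mathcal G$ (if $\mathcal S\neq\emptyset$), such that $p$ is a smooth submersion; the formulas $$\widetilde R(\tilde s,\tilde a)=R\big(s,\Psi_{\lambda(s)}(\tilde a)\big),\qquad \widetilde\tau(\widetilde B\mid\tilde s,\tilde a)=\tau\big(p^{-1}(\widetilde B)\mid s,\Psi_{\lambda(s)}(\tilde a)\big)\qquad(s\in p^{-1}(\tilde s),\ \widetilde B\in\mathsf B(\mathcal S/\mathcal G))$$ do not depend on the choice of $s\in p^{-1}(\tilde s)$ and define an MDP $\widetilde{\mathcal M}=(\mathcal S/\mathcal G,\mathcal A,\widetilde R,\widetilde\tau,\gamma)$; and $(p,h)$ is a continuous MDP homomorphism from $\mathcal M$ to $\widetilde{\mathcal M}$. Moreover, for any policy $\widetilde\pi$ for $\widetilde{\mathcal M}$, the formula $$(\widetilde\pi)^{\uparrow}(A\mid s)=\widetilde\pi\big(\Psi_{\lambda(s)^{-1}}(A)\mid p(s)\big),\qquad A\in\mathsf B(\mathcal A),\ s\in\mathcal S,$$ defines a policy for $\mathcal M$ that is a lift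 of $\widetilde\pi$. -/

import Mathlib

open scoped Manifold ContDiff
open MeasureTheory

/-- A continuous Markov decision process whose state space `S` and action space `A` are smooth
manifolds (finite-dimensional, without boundary, Hausdorff and second countable) with their Borel
`σ`-algebras. The reward, the transition dynamics and the policies are arbitrary maps; for each
state and action the transition is a Borel probability measure on `S`. -/
structure ContinuousMDP (m n : ℕ) (S A : Type*)
    [TopologicalSpace S] [ChartedSpace (EuclideanSpace ℝ (Fin m)) S] [IsManifold (𝓡 m) ∞ S]
    [T2Space S] [SecondCountableTopology S] [MeasurableSpace S] [BorelSpace S]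
    [TopologicalSpace A] [ChartedSpace (EuclideanSpace ℝ (Fin n)) A] [IsManifold (𝓡 n) ∞ A]
    [T2Space A] [SecondCountableTopology A] [MeasurableSpace A] [BorelSpace A] where
  /-- The instantaneous reward. -/
  reward : S × A → ℝ
  /-- The transition dynamics. -/
  transition : S × A → ProbabilityMeasure S
  /-- The discount factor. -/
  discount : ℝ
  discount_nonneg : 0 ≤ discount
  discount_lt_one : discount < 1

/-- A policy assigns to each state a Borel probability measure on the action space. -/
abbrev MDPPolicy (S A : Type*) [MeasurableSpace A] : Type _ := S → ProbabilityMeasure A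

namespace ContinuousMDP

/-- `(p, h)` is a continuous MDP homomorphism from `M` to `M'` (which have the same discount
factor). -/
structure IsHom {m n m' n' : ℕ} {S A S' A' : Type*}
    [TopologicalSpace S] [ChartedSpace (EuclideanSpace ℝ (Fin m)) S] [IsManifold (𝓡 m) ∞ S]
    [T2Space S] [SecondCountableTopology S] [MeasurableSpace S] [BorelSpace S]
    [TopologicalSpace A] [ChartedSpace (EuclideanSpace ℝ (Fin n)) A] [IsManifold (𝓡 n) ∞ A]
    [T2Space A] [SecondCountableTopology A] [MeasurableSpace A] [BorelSpace A]
    [TopologicalSpace S'] [ChartedSpace (EuclideanSpace ℝ (Fin m')) S'] [IsManifold (𝓡 m') ∞ S']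
    [T2Space S'] [SecondCountableTopology S'] [MeasurableSpace S'] [BorelSpace S']
    [TopologicalSpace A'] [ChartedSpace (EuclideanSpace ℝ (Fin n')) A'] [IsManifold (𝓡 n') ∞ A']
    [T2Space A'] [SecondCountableTopology A'] [MeasurableSpace A'] [BorelSpace A']
    (M : ContinuousMDP m n S A) (M' : ContinuousMDP m' n' S' A')
    (p : S → S') (h : S × A → A') : Prop where
  discount_eq : M'.discount = M.discount
  measurable_state : Measurable p
  surjective_state : Function.Surjective p
  measurable_action : ∀ s, Measurable fun a => h (s, a)
  surjective_action : ∀ s, Function.Surjective fun a => h (s, a)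
  reward_eq : ∀ s a, M.reward (s, a) = M'.reward (p s, h (s, a))
  transition_eq : ∀ s a (B' : Set S'), MeasurableSet B' →
    (M.transition (s, a) : Measure S) (p ⁻¹' B') = (M'.transition (p s, h (s, a)) : Measure S') B'

/-- The actions of `G` on `S` and `A` form a symmetry of `M`: the reward is invariant, and so is
the transition probability of every Borel set that is invariant under the action on `S`. -/
structure IsSymmetry {m n : ℕ} {S A : Type*}
    [TopologicalSpace S] [ChartedSpace (EuclideanSpace ℝ (Fin m)) S] [IsManifold (𝓡 m) ∞ S]
    [T2Space S] [SecondCountableTopology S] [MeasurableSpace S] [BorelSpace S]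
    [TopologicalSpace A] [ChartedSpace (EuclideanSpace ℝ (Fin n)) A] [IsManifold (𝓡 n) ∞ A]
    [T2Space A] [SecondCountableTopology A] [MeasurableSpace A] [BorelSpace A]
    (G : Type*) [Group G] [MulAction G S] [MulAction G A]
    (M : ContinuousMDP m n S A) : Prop where
  reward_eq : ∀ (g : G) (s : S) (a : A), M.reward (s, a) = M.reward (g • s, g • a)
  transition_eq : ∀ B : Set S, MeasurableSet B → (∀ (g : G) (s : S), g • s ∈ B ↔ s ∈ B) →
    ∀ (g : G) (s : S) (a : A),
      (M.transition (s, a) : Measure S) B = (M.transition (g • s, g • a) : Measure S) B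

end ContinuousMDP

/-- The policy `π` is a lift of the policy `π'` along the state map `p` and the action map `h`. -/
def IsPolicyLift {S A S' A' : Type*} [MeasurableSpace A] [MeasurableSpace A']
    (p : S → S') (h : S × A → A') (π' : MDPPolicy S' A') (π : MDPPolicy S A) : Prop :=
  ∀ (s : S) (A₀ : Set A'), MeasurableSet A₀ →
    (π s : Measure A) ((fun a => h (s, a)) ⁻¹' A₀) = (π' (p s) : Measure A') A₀

/-- The space of orbits of an action of `G` on `S`. -/
def OrbitSpace (G S : Type*) [Group G] [MulAction G S] : Type _ :=
  Quotient (MulAction.orbitRel G S)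

namespace OrbitSpace

/-- The map sending a point to its orbit. -/
def mk (G : Type*) {S : Type*} [Group G] [MulAction G S] (s : S) : OrbitSpace G S :=
  Quotient.mk (MulAction.orbitRel G S) s

/-- The quotient topology. -/
instance (G S : Type*) [Group G] [MulAction G S] [TopologicalSpace S] :
    TopologicalSpace (OrbitSpace G S) :=
  inferInstanceAs (TopologicalSpace (Quotient (MulAction.orbitRel G S)))

/-- The Borel `σ`-algebra of the quotient topology. -/
instance (G S : Type*) [Group G] [MulAction G S] [TopologicalSpace S] :
    MeasurableSpace (OrbitSpace G S) :=
  borel (OrbitSpace G S)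

instance (G S : Type*) [Group G] [MulAction G S] [TopologicalSpace S] :
    BorelSpace (OrbitSpace G S) :=
  ⟨rfl⟩

end OrbitSpace

/-!
The substance is the quotient manifold theorem: the orbit space of a free and proper smooth action
of a Lie group `G` on `S` is a smooth manifold and the orbit map is a submersion. The statements
about the MDPs then follow by pushing measures forward.

Freeness makes each orbit map `g ↦ g • s` an immersion at the identity
(`eq_zero_of_mfderiv_orbitMap_eq_zero`): a vector `v` in the kernel of its derivative generates a
left-invariant field whose integral curve through `1` moves `s` with zero velocity, so the curve
stays in the stabilizer of `s` and is constant. Take a small disc `sec` in `S` through `s` transverse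
to the orbit. By the inverse function theorem `(g, y) ↦ g • sec y` is a local diffeomorphism at
`(1, 0)`. Properness ensures that only elements near `1` can move a point of a small disc to another
of its points (`exists_isOpen_mem_of_smul_mem`), so a small disc meets each orbit at most once
(`exists_orbitSlice`).

The map `y ↦ [sec y]` is therefore injective, continuous and open, and its inverse is a chart of the
orbit space (`OrbitSlice.chart`). Locally, this chart composed with the orbit map is a translation
followed by the smooth projection onto the slice (`OrbitSlice.contMDiffOn_chart_comp_mk`). This gives
at once smooth transition maps and a smooth orbit map, and translates of slices are smooth local
sections, which makes the orbit map a submersion. Properness also makes the quotient Hausdorff.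

For the quotient MDP, two representatives of an orbit differ by some `g`, and equivariance of `lam`
makes the pair of `g • s` equal to `(g • s, g • lam s • a')`, which the symmetry identifies with
`(s, lam s • a')`. The lifted policy at `s` is the pushforward of the given one by the translation
`lam s`.
-/

open scoped Topology

/-! ### The orbit map of a free action is an immersion -/

section InfinitesimalFreeness

variable {E : Type*} [NormedAddCommGroup E] [NormedSpace ℝ E]
  {H : Type*} [TopologicalSpace H] (I : ModelWithCorners ℝ E H)
  {E' : Type*} [NormedAddCommGroup E'] [NormedSpace ℝ E']
  {H' : Type*} [TopologicalSpace H'] (I' : ModelWithCorners ℝ E' H')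
  {G : Type*} [TopologicalSpace G] [ChartedSpace H G] [Group G]
  {S : Type*} [TopologicalSpace S] [ChartedSpace H' S]
  [MulAction G S] [ContMDiffSMul I I' ∞ G S]

lemma contMDiff_orbitMap (s : S) : ContMDiff I I' ∞ (fun g : G => g • s) :=
  (contMDiff_smul (I := I) (I' := I') (n := ∞) (G := G) (M := S)).comp
    (contMDiff_id.prodMk contMDiff_const)

lemma contMDiff_translation (I : ModelWithCorners ℝ E H) [ContMDiffSMul I I' ∞ G S] (g : G) :
    ContMDiff I' I' ∞ (fun s : S => g • s) :=
  (contMDiff_smul (I := I) (I' := I') (n := ∞) (G := G) (M := S)).comp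
    (contMDiff_const.prodMk contMDiff_id)

variable {I I'}

variable [LieGroup I ∞ G]

/-- By equivariance of the orbit map `g ↦ g • s`, its derivative kills a whole left-invariant vector
field as soon as it kills the value at the identity. -/
lemma mfderiv_orbitMap_mulInvariantVectorField_eq_zero {s : S} {v : GroupLieAlgebra I G}
    (hv : mfderiv I I' (fun g : G => g • s) 1 v = 0) (g : G) :
    mfderiv I I' (fun g : G => g • s) g (mulInvariantVectorField v g) = 0 := by
  have hθ := fun g : G => (contMDiff_orbitMap I I' (G := G) s).mdifferentiableAt
    (by simp) (x := g)
  have hmul : MDifferentiableAt I I (fun x : G => g * x) 1 :=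
    ((contMDiff_mul_left (I := I) (n := ∞) (a := g)).mdifferentiableAt (by simp))
  have h₁ : mfderiv I I' ((fun x : G => x • s) ∘ fun x => g * x) 1 v =
      mfderiv I I' (fun x : G => x • s) (g * 1) (mfderiv I I (fun x : G => g * x) 1 v) := by
    rw [mfderiv_comp_apply (I' := I) _ (hθ _) hmul]
  have h₂ : ((fun x : G => x • s) ∘ fun x => g * x) = (fun y : S => g • y) ∘ fun x => x • s := by
    ext x; simp [mul_smul]
  rw [h₂, mfderiv_comp_apply (I' := I') _
    ((contMDiff_translation I' I g).mdifferentiableAt (by simp)) (hθ _), hv] at h₁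
  rw [map_zero, mul_one] at h₁
  exact h₁.symm

variable [CompleteSpace E] [IsManifold I' ∞ S]
  [BoundarylessManifold I G] [BoundarylessManifold I' S]

/-- The orbit map of a free action is an immersion at the identity: if its derivative kills `v`, the
integral curve of the left-invariant field of `v` through `1` fixes `s`, hence is constant. -/
theorem eq_zero_of_mfderiv_orbitMap_eq_zero (hfree : ∀ (g : G) (s : S), g • s = s → g = 1)
    {s : S} {v : GroupLieAlgebra I G}
    (hv : mfderiv I I' (fun g : G => g • s) 1 v = 0) : v = 0 := by
  have : LieGroup I (minSmoothness ℝ 3) G :=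
    LieGroup.of_le (n := ∞) (by
      rw [minSmoothness_of_isRCLikeNormedField]
      exact WithTop.coe_le_coe.2 (le_top : (3 : ℕ∞) ≤ ⊤))
  have : IsManifold I 1 G := IsManifold.of_le (n := ∞) (by simp)
  have : IsManifold I' 1 S := IsManifold.of_le (n := ∞) (by simp)
  obtain ⟨γ, hγ0, hγ⟩ := exists_isMIntegralCurveAt_of_contMDiffAt_boundaryless (t₀ := 0)
    (((contMDiff_mulInvariantVectorField v).contMDiffAt (x := (1 : G))).of_le
      (by simp : (1 : WithTop ℕ∞) ≤ minSmoothness ℝ 2))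
  -- `t ↦ γ t • s` and the constant curve are both integral curves of the zero field.
  have hc : IsMIntegralCurveAt (fun t => γ t • s) (fun x : S => (0 : TangentSpace I' x)) 0 := by
    filter_upwards [hγ] with t ht
    have h1 : HasMFDerivAt I I' (fun g : G => g • s) (γ t) _ :=
      ((contMDiff_orbitMap I I' (G := G) s).mdifferentiableAt (by simp)).hasMFDerivAt
    refine (h1.comp t ht).congr_mfderiv ?_
    refine ContinuousLinearMap.ext_ring ?_
    change mfderiv I I' (fun g : G => g • s) (γ t) ((1 : ℝ) • mulInvariantVectorField v (γ t)) =
      (1 : ℝ) • (0 : TangentSpace I' (γ t • s))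
    rw [one_smul, smul_zero]
    exact mfderiv_orbitMap_mulInvariantVectorField_eq_zero hv (γ t)
  have hc' : IsMIntegralCurveAt (fun _ => γ 0 • s) (fun x : S => (0 : TangentSpace I' x)) 0 := by
    refine Filter.Eventually.of_forall fun t => ?_
    refine (hasMFDerivAt_const (γ 0 • s) t).congr_mfderiv ?_
    exact ContinuousLinearMap.ext_ring (smul_zero (1 : ℝ)).symm
  have key := isMIntegralCurveAt_eventuallyEq_of_contMDiffAt_boundaryless
    ((Bundle.contMDiff_zeroSection ℝ (TangentSpace I' : S → Type _)).contMDiffAt) hc hc' rfl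
  have hγc : γ =ᶠ[𝓝 0] fun _ => 1 := by
    filter_upwards [key] with t ht
    exact hfree _ _ (by simpa [hγ0] using ht)
  have hd := hγ.self_of_nhds
  have h0 := (hasMFDerivAt_const (I := 𝓘(ℝ, ℝ)) (I' := I) (1 : G) (0 : ℝ))
    |>.congr_of_eventuallyEq hγc
  have := hasMFDerivAt_unique hd h0
  have h3 : (1 : ℝ) • mulInvariantVectorField v (γ 0) = 0 := congrArg (fun L => L (1 : ℝ)) this
  rw [one_smul, hγ0, mulInvariantVectorField] at h3
  have h4 : (fun x : G => 1 * x) = id := by ext; simp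
  rw [h4, mfderiv_id] at h3
  exact h3

end InfinitesimalFreeness

/-! ### Slices for free proper actions -/

/-- The inverse function theorem, with an inverse that is smooth on its whole domain. -/
theorem ContDiffOn.exists_openPartialHomeomorph {E F : Type*}
    [NormedAddCommGroup E] [NormedSpace ℝ E] [CompleteSpace E]
    [NormedAddCommGroup F] [NormedSpace ℝ F] {f : E → F} {O : Set E} {a : E}
    (hf : ContDiffOn ℝ ∞ f O) (hO : IsOpen O) (ha : a ∈ O) {f' : E ≃L[ℝ] F}
    (hf' : HasFDerivAt f (f' : E →L[ℝ] F) a) :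
    ∃ e : OpenPartialHomeomorph E F, a ∈ e.source ∧ e.source ⊆ O ∧ (e : E → F) = f ∧
      ContDiffOn ℝ ∞ e.symm e.target := by
  have hfa : ∀ x ∈ O, ContDiffAt ℝ ∞ f x := fun x hx => hf.contDiffAt (hO.mem_nhds hx)
  -- Smoothness of the inverse needs an invertible derivative at every point of the source, so the
  -- homeomorphism is restricted to the open set `P` of such points.
  let e₀ := (hfa a ha).toOpenPartialHomeomorph f hf' (by simp)
  let P : Set E := O ∩ fderiv ℝ f ⁻¹' Set.range ((↑) : (E ≃L[ℝ] F) → (E →L[ℝ] F))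
  have hP : IsOpen P := (hf.continuousOn_fderiv_of_isOpen hO (by simp)).isOpen_inter_preimage hO
    ContinuousLinearEquiv.isOpen
  refine ⟨e₀.restrOpen P hP, ⟨(hfa a ha).mem_toOpenPartialHomeomorph_source hf' _, ha, f', ?_⟩,
    fun x hx => hx.2.1, rfl, ?_⟩
  · exact hf'.fderiv.symm
  · intro y hy
    obtain ⟨-, hO', f'', hf''⟩ := (e₀.restrOpen P hP).map_target hy
    refine ((e₀.restrOpen P hP).contDiffAt_symm (f₀' := f'') hy ?_ (hfa _ hO')).contDiffWithinAt
    rw [hf'']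
    exact ((hfa _ hO').differentiableAt (by simp)).hasFDerivAt

/-- A complement of the range of an injective linear map, parametrised by any space `F` of the right
dimension. -/
lemma exists_complementary_continuousLinearMap {E E' F : Type*}
    [NormedAddCommGroup E] [NormedSpace ℝ E] [FiniteDimensional ℝ E]
    [NormedAddCommGroup E'] [NormedSpace ℝ E'] [FiniteDimensional ℝ E']
    [NormedAddCommGroup F] [NormedSpace ℝ F] [FiniteDimensional ℝ F]
    (hdim : Module.finrank ℝ F + Module.finrank ℝ E = Module.finrank ℝ E')
    {L : E →L[ℝ] E'} (hL : Function.Injective L) :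
    ∃ j : F →L[ℝ] E', ∀ (u : E) (w : F), L u + j w = 0 → u = 0 ∧ w = 0 := by
  obtain ⟨W, hW⟩ := Submodule.exists_isCompl (LinearMap.range (L : E →ₗ[ℝ] E'))
  have h1 := Submodule.finrank_add_eq_of_isCompl hW
  have h2 := LinearMap.finrank_range_of_inj (f := (L : E →ₗ[ℝ] E')) hL
  let j₀ : F ≃ₗ[ℝ] W := LinearEquiv.ofFinrankEq F W (by omega)
  refine ⟨LinearMap.toContinuousLinearMap (W.subtype ∘ₗ j₀.toLinearMap), fun u w h => ?_⟩
  have h' : L u + (j₀ w : E') = 0 := h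
  have hd := Submodule.disjoint_def.1 hW.disjoint (L u) ⟨u, rfl⟩ (by
    rw [eq_neg_of_add_eq_zero_left h']
    exact W.neg_mem (j₀ w).2)
  have hw : (j₀ w : E') = 0 := by simpa [hd] using h'
  exact ⟨hL (by simpa using hd), by simpa using hw⟩

/-- A local slice for the action of `G` on `S`, parametrised by an open subset `V` of `F`: a smooth
map `sec` on `V` that meets each orbit at most once, with a smooth map `proj` on an open set
`U ⊇ sec '' V` that reads off the parameter of the orbit of a point. -/
structure OrbitSlice {E' : Type*} [NormedAddCommGroup E'] [NormedSpace ℝ E']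
    {H' : Type*} [TopologicalSpace H'] (I' : ModelWithCorners ℝ E' H')
    (F : Type*) [NormedAddCommGroup F] [NormedSpace ℝ F]
    (G S : Type*) [Group G] [TopologicalSpace S] [ChartedSpace H' S] [MulAction G S] where
  /-- The parameter domain of the slice. -/
  V : Set F
  isOpen_V : IsOpen V
  /-- The parametrisation of the slice. -/
  sec : F → S
  contMDiffOn_sec : ContMDiffOn 𝓘(ℝ, F) I' ∞ sec V
  eq_of_smul_sec_eq : ∀ g : G, ∀ y ∈ V, ∀ z ∈ V, g • sec y = sec z → y = z
  /-- An open neighbourhood of the slice. -/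
  U : Set S
  isOpen_U : IsOpen U
  mapsTo_sec : Set.MapsTo sec V U
  /-- The projection onto the parameter domain along the orbits. -/
  proj : S → F
  contMDiffOn_proj : ContMDiffOn I' 𝓘(ℝ, F) ∞ proj U
  mapsTo_proj : Set.MapsTo proj U V
  exists_smul_sec_proj : ∀ s ∈ U, ∃ g : G, g • sec (proj s) = s

section Slice

variable {E : Type*} [NormedAddCommGroup E] [NormedSpace ℝ E] [FiniteDimensional ℝ E]
  {H : Type*} [TopologicalSpace H] {I : ModelWithCorners ℝ E H} [I.Boundaryless]
  {E' : Type*} [NormedAddCommGroup E'] [NormedSpace ℝ E']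
  {H' : Type*} [TopologicalSpace H'] {I' : ModelWithCorners ℝ E' H'} [I'.Boundaryless]
  {G : Type*} [TopologicalSpace G] [ChartedSpace H G] [Group G] [LieGroup I ∞ G]
  {S : Type*} [TopologicalSpace S] [ChartedSpace H' S] [IsManifold I' ∞ S]
  [MulAction G S] [ContMDiffSMul I I' ∞ G S]

/-- The orbit map `g ↦ g • s`, read in charts around `1` and `s`, has an injective derivative at
`1`. -/
lemma exists_injective_hasFDerivAt_orbitMap (hfree : ∀ (g : G) (s : S), g • s = s → g = 1)
    (s : S) :
    ∃ L : E →L[ℝ] E', Function.Injective L ∧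
      HasFDerivAt (fun x : E => extChartAt I' s ((extChartAt I (1 : G)).symm x • s)) L
        (extChartAt I (1 : G) 1) := by
  have : IsManifold I 1 G := IsManifold.of_le (n := ∞) (by simp)
  have : IsManifold I' 1 S := IsManifold.of_le (n := ∞) (by simp)
  set x₀ := extChartAt I (1 : G) 1
  have hx₀t : x₀ ∈ (extChartAt I (1 : G)).target := mem_extChartAt_target 1
  have hg : (extChartAt I (1 : G)).symm x₀ = 1 := extChartAt_to_inv 1
  have hs : (extChartAt I (1 : G)).symm x₀ • s ∈ (extChartAt I' s).source := by
    rw [hg, one_smul]; exact mem_extChartAt_source s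
  have hψi := isInvertible_mfderivWithin_extChartAt_symm (I := I) hx₀t
  have hψd := (contMDiffOn_extChartAt_symm (I := I) (n := 1) (1 : G)).contMDiffAt
    ((isOpen_extChartAt_target (I := I) (1 : G)).mem_nhds hx₀t) |>.mdifferentiableAt (by simp)
  rw [ModelWithCorners.range_eq_univ, mfderivWithin_univ] at hψi
  have hθ := ((contMDiff_orbitMap I I' (G := G) s).mdifferentiableAt (by simp)
    (x := (extChartAt I (1 : G)).symm x₀))
  have hφd := mdifferentiableAt_extChartAt (I := I') ((extChartAt_source I' s).subset hs)
  have hφi := isInvertible_mfderiv_extChartAt (I := I') hs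
  have hθi : Function.Injective (mfderiv I I' (fun g : G => g • s)
      ((extChartAt I (1 : G)).symm x₀)) := by
    rw [hg]
    exact (injective_iff_map_eq_zero _).2 fun v hv => eq_zero_of_mfderiv_orbitMap_eq_zero hfree hv
  have hcomp := hφd.hasMFDerivAt.comp x₀ (hθ.hasMFDerivAt.comp x₀ hψd.hasMFDerivAt)
  let A : E →L[ℝ] E := mfderiv 𝓘(ℝ, E) I (extChartAt I (1 : G)).symm x₀
  let B : E →L[ℝ] E' := mfderiv I I' (fun g : G => g • s) ((extChartAt I (1 : G)).symm x₀)
  let C : E' →L[ℝ] E' :=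
    mfderiv I' 𝓘(ℝ, E') (extChartAt I' s) ((extChartAt I (1 : G)).symm x₀ • s)
  have hinj : Function.Injective (C ∘ B ∘ A) := hφi.injective.comp (hθi.comp hψi.injective)
  exact ⟨C.comp (B.comp A), hinj, hcomp.hasFDerivAt⟩

variable (G) in
/-- For a free proper action, an element that moves some point near `s₀` to a point near `s₀` is
near `1`: the image of `Nᶜ × S` under the proper map `(g, s) ↦ (g • s, s)` is closed and, by
freeness, misses `(s₀, s₀)`. -/
lemma exists_isOpen_mem_of_smul_mem [ProperSMul G S]
    (hfree : ∀ (g : G) (s : S), g • s = s → g = 1) (s₀ : S) {N : Set G} (hN : IsOpen N)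
    (h1 : 1 ∈ N) :
    ∃ W : Set S, IsOpen W ∧ s₀ ∈ W ∧ ∀ (g : G), ∀ s ∈ W, g • s ∈ W → g ∈ N := by
  have hC := (ProperSMul.isProperMap_smul_pair (G := G) (X := S)).isClosedMap (Nᶜ ×ˢ Set.univ)
    (hN.isClosed_compl.prod isClosed_univ)
  have hmem : (s₀, s₀) ∈ ((fun x : G × S => (x.1 • x.2, x.2)) '' (Nᶜ ×ˢ Set.univ))ᶜ := by
    rintro ⟨⟨g, s⟩, ⟨hg, -⟩, h⟩
    obtain ⟨h, rfl⟩ := Prod.mk.inj h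
    exact hg (hfree g s h ▸ h1)
  obtain ⟨W₁, W₂, hW₁, hs₁, hW₂, hs₂, hsub⟩ := mem_nhds_prod_iff'.1 (hC.isOpen_compl.mem_nhds hmem)
  refine ⟨W₁ ∩ W₂, hW₁.inter hW₂, ⟨hs₁, hs₂⟩, fun g s hs hgs => ?_⟩
  by_contra hg
  exact hsub (Set.mk_mem_prod hgs.1 hs.2) ⟨(g, s), ⟨hg, trivial⟩, rfl⟩

/-- The slice theorem for free proper actions. In a chart around `s₀`, the slice is an affine subspace
transverse to the orbit of `s₀`. -/
theorem exists_orbitSlice [FiniteDimensional ℝ E'] {H : Type*} [TopologicalSpace H]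
    (I : ModelWithCorners ℝ E H) [I.Boundaryless] [ChartedSpace H G] [LieGroup I ∞ G]
    [ContMDiffSMul I I' ∞ G S] {F : Type*} [NormedAddCommGroup F]
    [NormedSpace ℝ F] [FiniteDimensional ℝ F]
    (hdim : Module.finrank ℝ F + Module.finrank ℝ E = Module.finrank ℝ E') [ProperSMul G S]
    (hfree : ∀ (g : G) (s : S), g • s = s → g = 1) (s₀ : S) :
    ∃ σ : OrbitSlice I' F G S, ∃ y ∈ σ.V, σ.sec y = s₀ := by
  obtain ⟨L, hL, hLf⟩ := exists_injective_hasFDerivAt_orbitMap (I := I) (I' := I') hfree s₀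
  obtain ⟨j, hj⟩ := exists_complementary_continuousLinearMap hdim hL
  let φ := extChartAt I' s₀
  let ψ := extChartAt I (1 : G)
  let x₀ : E := ψ 1
  have hx₀t : x₀ ∈ ψ.target := mem_extChartAt_target 1
  have hx₀ : ψ.symm x₀ = 1 := extChartAt_to_inv 1
  let sec : F → S := fun y => φ.symm (φ s₀ + j y)
  let V₁ : Set F := (fun y => φ s₀ + j y) ⁻¹' φ.target
  have haff : ContDiff ℝ ∞ (fun y : F => φ s₀ + j y) := contDiff_const.add j.contDiff
  have hV₁ : IsOpen V₁ := (isOpen_extChartAt_target s₀).preimage haff.continuous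
  have hsec0 : sec 0 = s₀ := by simp [sec, φ]
  have h0V₁ : (0 : F) ∈ V₁ := by
    change φ s₀ + j 0 ∈ φ.target
    rw [map_zero, add_zero]; exact mem_extChartAt_target s₀
  have hsec : ContMDiffOn 𝓘(ℝ, F) I' ∞ sec V₁ :=
    (contMDiffOn_extChartAt_symm s₀).comp haff.contMDiff.contMDiffOn subset_rfl
  have hφsec : ∀ y ∈ V₁, φ (sec y) = φ s₀ + j y := fun y hy => φ.right_inv hy
  have hsecφ : ∀ y ∈ V₁, sec y ∈ φ.source := fun y hy => φ.map_target hy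
  -- `Φ` is the action map `(g, y) ↦ g • sec y`, read in a chart of `G`; `f` also reads its values in
  -- the chart of `S`.
  let Φ : E × F → S := fun x => ψ.symm x.1 • sec x.2
  let O₁ : Set (E × F) := ψ.target ×ˢ V₁
  have hO₁ : IsOpen O₁ := (isOpen_extChartAt_target 1).prod hV₁
  have hΦ : ContMDiffOn 𝓘(ℝ, E × F) I' ∞ Φ O₁ := by
    have h1 : ContMDiffOn 𝓘(ℝ, E × F) I ∞ (fun x : E × F => ψ.symm x.1) O₁ :=
      (contMDiffOn_extChartAt_symm 1).comp contDiff_fst.contMDiff.contMDiffOn fun x hx => hx.1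
    have h2 : ContMDiffOn 𝓘(ℝ, E × F) I' ∞ (fun x : E × F => sec x.2) O₁ :=
      hsec.comp contDiff_snd.contMDiff.contMDiffOn fun x hx => hx.2
    exact (contMDiff_smul (I := I) (I' := I') (n := ∞) (G := G) (M := S)).comp_contMDiffOn
      (h1.prodMk h2)
  let O : Set (E × F) := O₁ ∩ Φ ⁻¹' φ.source
  have hO : IsOpen O :=
    hΦ.continuousOn.isOpen_inter_preimage hO₁ (isOpen_extChartAt_source s₀)
  let f : E × F → E' := φ ∘ Φ
  have hf : ContDiffOn ℝ ∞ f O := contMDiffOn_iff_contDiffOn.1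
    (((contMDiffOn_extChartAt (I := I') (x := s₀)).comp (hΦ.mono Set.inter_subset_left)
      fun x hx => (extChartAt_source I' s₀).subset hx.2))
  have hΦx₀ : ∀ y, Φ (x₀, y) = sec y := fun y => by simp only [Φ, hx₀, one_smul]
  have ha : (x₀, (0 : F)) ∈ O := by
    refine ⟨⟨hx₀t, h0V₁⟩, ?_⟩
    rw [Set.mem_preimage, hΦx₀]
    exact hsecφ 0 h0V₁
  have hD : HasFDerivAt f (fderiv ℝ f (x₀, 0)) (x₀, 0) :=
    ((hf.contDiffAt (hO.mem_nhds ha)).differentiableAt (by simp)).hasFDerivAt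
  have hD1 : ∀ u, fderiv ℝ f (x₀, 0) (u, 0) = L u := fun u => by
    have h1 := hD.comp x₀ (hasFDerivAt_prodMk_left (𝕜 := ℝ) x₀ (0 : F))
    have h2 : f ∘ (fun x => (x, 0)) = fun x : E => φ (ψ.symm x • s₀) := by
      ext x; simp only [f, Φ, Function.comp_apply, hsec0]
    rw [h2] at h1
    exact congrArg (fun T : E →L[ℝ] E' => T u) (h1.unique hLf)
  have hD2 : ∀ w, fderiv ℝ f (x₀, 0) (0, w) = j w := fun w => by
    have h1 := hD.comp (0 : F) (hasFDerivAt_prodMk_right (𝕜 := ℝ) x₀ (0 : F))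
    have h2 : f ∘ (fun y => (x₀, y)) =ᶠ[𝓝 0] fun y : F => φ s₀ + j y := by
      filter_upwards [hV₁.mem_nhds h0V₁] with y hy
      simp only [f, Function.comp_apply, hΦx₀, hφsec y hy]
    have h3 := (j.hasFDerivAt (x := 0)).const_add (φ s₀)
    exact congrArg (fun T : F →L[ℝ] E' => T w) ((h1.congr_of_eventuallyEq h2.symm).unique h3)
  -- The derivative of `f` is `(u, w) ↦ L u + j w`, an isomorphism by the choice of `j`.
  have hDinj : Function.Injective (fderiv ℝ f (x₀, 0) : E × F →ₗ[ℝ] E') := by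
    refine (injective_iff_map_eq_zero _).2 fun ⟨u, w⟩ huw => ?_
    have h : fderiv ℝ f (x₀, 0) ((u, 0) + (0, w)) = 0 := by simpa using huw
    rw [map_add, hD1, hD2] at h
    obtain ⟨rfl, rfl⟩ := hj u w h
    rfl
  let D : (E × F) ≃L[ℝ] E' := (LinearMap.linearEquivOfInjective _ hDinj
    (by rw [Module.finrank_prod, add_comm, hdim])).toContinuousLinearEquiv
  have hD' : HasFDerivAt f (D : E × F →L[ℝ] E') (x₀, 0) := by
    convert hD using 1
    ext x <;> rfl
  obtain ⟨e, hae, heO, hef, he⟩ := hf.exists_openPartialHomeomorph hO ha hD'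
  obtain ⟨X, Y, hX, hxX, hY, h0Y, hXY⟩ := mem_nhds_prod_iff'.1 (e.open_source.mem_nhds hae)
  let N : Set G := ψ.source ∩ ψ ⁻¹' X
  have hN : IsOpen N := (continuousOn_extChartAt (1 : G)).isOpen_inter_preimage
    (isOpen_extChartAt_source 1) hX
  obtain ⟨W, hW, hsW, hWN⟩ := exists_isOpen_mem_of_smul_mem G hfree s₀ hN
    ⟨mem_extChartAt_source 1, hxX⟩
  -- On `V`, an element taking `sec y` to `sec z` lies in `N`, where the inverse function theorem
  -- applies; this makes `y = z` although `g` is not assumed small.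
  let V : Set F := V₁ ∩ sec ⁻¹' W ∩ Y
  have hV : IsOpen V := (hsec.continuousOn.isOpen_inter_preimage hV₁ hW).inter hY
  have hx₀V : ∀ y ∈ V, (x₀, y) ∈ e.source := fun y hy => hXY ⟨hxX, hy.2⟩
  have hex₀ : ∀ y, e (x₀, y) = φ (sec y) := fun y => by
    rw [hef, ← hΦx₀]; rfl
  let σ : OrbitSlice I' F G S :=
    { V := V
      isOpen_V := hV
      sec := sec
      contMDiffOn_sec := hsec.mono fun y hy => hy.1.1
      eq_of_smul_sec_eq := fun g y hy z hz h => by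
        have hg : g ∈ N := hWN g (sec y) hy.1.2 (h ▸ hz.1.2)
        have h1 : e (ψ g, y) = e (x₀, z) := by
          rw [hex₀, ← h, hef]
          change φ (ψ.symm (ψ g) • sec y) = _
          rw [ψ.left_inv hg.1]
        exact (Prod.mk.inj (e.injOn (hXY (Set.mk_mem_prod (a := ψ g) hg.2 hy.2)) (hx₀V z hz) h1)).2
      U := φ.source ∩ φ ⁻¹' (e.target ∩ e.symm ⁻¹' (Prod.snd ⁻¹' V))
      isOpen_U := (continuousOn_extChartAt s₀).isOpen_inter_preimage (isOpen_extChartAt_source s₀)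
        (e.symm.isOpen_inter_preimage (hV.preimage continuous_snd))
      mapsTo_sec := fun y hy => by
        refine ⟨hsecφ y hy.1.1, ?_, ?_⟩
        · rw [← hex₀]
          exact e.map_source (hx₀V y hy)
        · rw [Set.mem_preimage, ← hex₀, e.left_inv (hx₀V y hy)]
          exact hy
      proj := fun s => (e.symm (φ s)).2
      contMDiffOn_proj := by
        refine contDiff_snd.contMDiff.comp_contMDiffOn
          (he.contMDiffOn.comp ((contMDiffOn_extChartAt (x := s₀)).mono ?_) fun s hs => hs.2.1)
        exact fun s hs => (extChartAt_source I' s₀).subset hs.1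
      mapsTo_proj := fun s hs => hs.2.2
      exists_smul_sec_proj := fun s hs => by
        refine ⟨ψ.symm (e.symm (φ s)).1, ?_⟩
        have h1 := e.map_target hs.2.1
        refine φ.injOn (heO h1).2 hs.1 ?_
        have h2 := e.right_inv hs.2.1
        rw [hef] at h2
        exact h2 }
  exact ⟨σ, 0, ⟨⟨h0V₁, by rwa [Set.mem_preimage, hsec0]⟩, h0Y⟩, hsec0⟩

end Slice

/-! ### The smooth structure of the orbit space -/

namespace OrbitSpace

variable {G S : Type*} [Group G] [MulAction G S]

lemma mk_surjective : Function.Surjective (OrbitSpace.mk G : S → OrbitSpace G S) :=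
  Quotient.mk_surjective

lemma mk_eq_mk {s t : S} : (mk G s = mk G t) ↔ ∃ g : G, g • t = s :=
  Quotient.eq''.trans (MulAction.orbitRel_apply.trans Iff.rfl)

lemma mk_smul (g : G) (s : S) : mk G (g • s) = mk G s :=
  mk_eq_mk.2 ⟨g, rfl⟩

lemma isOpenQuotientMap_mk [TopologicalSpace S] [ContinuousConstSMul G S] :
    IsOpenQuotientMap (mk G : S → OrbitSpace G S) :=
  MulAction.isOpenQuotientMap_quotientMk

end OrbitSpace

open OrbitSpace

namespace OrbitSlice

variable {E' : Type*} [NormedAddCommGroup E'] [NormedSpace ℝ E']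
  {H' : Type*} [TopologicalSpace H'] {I' : ModelWithCorners ℝ E' H'}
  {F : Type*} [NormedAddCommGroup F] [NormedSpace ℝ F]
  {G S : Type*} [Group G] [TopologicalSpace S] [ChartedSpace H' S] [MulAction G S]

lemma injOn_mk_sec (σ : OrbitSlice I' F G S) : Set.InjOn (fun y => OrbitSpace.mk G (σ.sec y)) σ.V := by
  intro y hy z hz h
  obtain ⟨g, hg⟩ := mk_eq_mk.1 h
  exact (σ.eq_of_smul_sec_eq g z hz y hy hg).symm

lemma mk_sec_proj (σ : OrbitSlice I' F G S) {s : S} (hs : s ∈ σ.U) :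
    OrbitSpace.mk G (σ.sec (σ.proj s)) = OrbitSpace.mk G s := by
  obtain ⟨g, hg⟩ := σ.exists_smul_sec_proj s hs
  exact (mk_eq_mk.2 ⟨g, hg⟩).symm

lemma proj_sec (σ : OrbitSlice I' F G S) {y : F} (hy : y ∈ σ.V) : σ.proj (σ.sec y) = y :=
  σ.injOn_mk_sec (σ.mapsTo_proj (σ.mapsTo_sec hy)) hy (σ.mk_sec_proj (σ.mapsTo_sec hy))

variable [ContinuousConstSMul G S]

/-- The chart of the orbit space given by a slice: it sends an orbit to the parameter of the point
where the orbit meets the slice. -/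
noncomputable def chart (σ : OrbitSlice I' F G S) : OpenPartialHomeomorph (OrbitSpace G S) F :=
  (OpenPartialHomeomorph.ofContinuousOpenRestrict (σ.injOn_mk_sec.toPartialEquiv _ _)
    (isOpenQuotientMap_mk.continuous.comp_continuousOn σ.contMDiffOn_sec.continuousOn)
    (by
      rintro T ⟨T', hT', rfl⟩
      have h : IsOpen (OrbitSpace.mk G '' (σ.U ∩ σ.proj ⁻¹' T')) := isOpenQuotientMap_mk.isOpenMap _
        (σ.contMDiffOn_proj.continuousOn.isOpen_inter_preimage σ.isOpen_U hT')
      convert h using 1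
      ext q
      constructor
      · rintro ⟨⟨y, hy⟩, hyT, rfl⟩
        refine ⟨σ.sec y, ⟨σ.mapsTo_sec hy, ?_⟩, rfl⟩
        rw [Set.mem_preimage, σ.proj_sec hy]
        exact hyT
      · rintro ⟨s, ⟨hs, hsT⟩, rfl⟩
        exact ⟨⟨σ.proj s, σ.mapsTo_proj hs⟩, hsT, σ.mk_sec_proj hs⟩)
    σ.isOpen_V).symm

lemma mem_chart_source_iff (σ : OrbitSlice I' F G S) {q : OrbitSpace G S} :
    q ∈ σ.chart.source ↔ ∃ y ∈ σ.V, OrbitSpace.mk G (σ.sec y) = q := Iff.rfl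

lemma mk_mem_chart_source (σ : OrbitSlice I' F G S) {s : S} (hs : s ∈ σ.U) :
    OrbitSpace.mk G s ∈ σ.chart.source :=
  σ.mem_chart_source_iff.2 ⟨σ.proj s, σ.mapsTo_proj hs, σ.mk_sec_proj hs⟩

lemma chart_mk (σ : OrbitSlice I' F G S) {s : S} (hs : s ∈ σ.U) :
    σ.chart (OrbitSpace.mk G s) = σ.proj s := by
  rw [← σ.mk_sec_proj hs]
  exact σ.chart.right_inv (σ.mapsTo_proj hs)

/-- Near any point of the orbits through the slice, the chart composed with the orbit map is `proj`
precomposed with a translation that moves the point into `U`. -/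
lemma contMDiffOn_chart_comp_mk (σ : OrbitSlice I' F G S)
    (hsmul : ∀ g : G, ContMDiff I' I' ∞ (fun s : S => g • s)) :
    ContMDiffOn I' 𝓘(ℝ, F) ∞ (fun s => σ.chart (OrbitSpace.mk G s)) (OrbitSpace.mk G ⁻¹' σ.chart.source) := by
  intro s hs
  obtain ⟨y, hy, hys⟩ := σ.mem_chart_source_iff.1 hs
  obtain ⟨g, hg⟩ := mk_eq_mk.1 hys
  have hgU : g • s ∈ σ.U := hg ▸ σ.mapsTo_sec hy
  have h1 : ContMDiffAt I' 𝓘(ℝ, F) ∞ (fun t => σ.proj (g • t)) s :=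
    (σ.contMDiffOn_proj.contMDiffAt (σ.isOpen_U.mem_nhds hgU)).comp s (hsmul g).contMDiffAt
  refine (h1.congr_of_eventuallyEq ?_).contMDiffWithinAt
  filter_upwards [(σ.isOpen_U.preimage (hsmul g).continuous).mem_nhds hgU] with t ht
  rw [← mk_smul g t, σ.chart_mk ht]

/-- The transition between two charts is the second chart along the first slice, so the smoothness of
`chart ∘ mk` and of `sec` gives it. -/
lemma contDiffOn_chart_symm_trans (σ τ : OrbitSlice I' F G S)
    (hsmul : ∀ g : G, ContMDiff I' I' ∞ (fun s : S => g • s)) :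
    ContDiffOn ℝ ∞ (σ.chart.symm.trans τ.chart) (σ.chart.symm.trans τ.chart).source := by
  refine contMDiffOn_iff_contDiffOn.1 ?_
  exact (τ.contMDiffOn_chart_comp_mk hsmul).comp
    (σ.contMDiffOn_sec.mono fun y hy => hy.1) fun y hy => hy.2

/-- The charted space structure on the orbit space given by slices around all points. -/
@[reducible] noncomputable def chartedSpace (σ : S → OrbitSlice I' F G S)
    (hσ : ∀ s, s ∈ (σ s).U) :
    ChartedSpace F (OrbitSpace G S) where
  atlas := Set.range fun s => (σ s).chart
  chartAt q := (σ (Quotient.out q)).chart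
  mem_chart_source q := by
    have h := (σ (Quotient.out q)).mk_mem_chart_source (hσ (Quotient.out q))
    rwa [show OrbitSpace.mk G (Quotient.out q) = q from Quotient.out_eq q] at h
  chart_mem_atlas q := ⟨_, rfl⟩

variable (σ : S → OrbitSlice I' F G S) (hσ : ∀ s, s ∈ (σ s).U)

theorem isManifold_chartedSpace
    (hsmul : ∀ g : G, ContMDiff I' I' ∞ (fun s : S => g • s)) :
    letI := chartedSpace σ hσ
    IsManifold 𝓘(ℝ, F) ∞ (OrbitSpace G S) := by
  let := chartedSpace σ hσ
  refine isManifold_of_contDiffOn _ _ _ ?_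
  rintro _ _ ⟨s, rfl⟩ ⟨t, rfl⟩
  simpa using contDiffOn_chart_symm_trans (σ s) (σ t) hsmul

theorem contMDiff_mk (hsmul : ∀ g : G, ContMDiff I' I' ∞ (fun s : S => g • s)) :
    letI := chartedSpace σ hσ
    ContMDiff I' 𝓘(ℝ, F) ∞ (OrbitSpace.mk G : S → OrbitSpace G S) := by
  let := chartedSpace σ hσ
  intro s
  refine contMDiffAt_iff_target.2 ⟨isOpenQuotientMap_mk.continuous.continuousAt, ?_⟩
  have hc := mem_chart_source F (OrbitSpace.mk G s)
  exact ((σ (Quotient.out (OrbitSpace.mk G s))).contMDiffOn_chart_comp_mk hsmul).contMDiffAt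
    ((((chartAt F (OrbitSpace.mk G s)).open_source.preimage isOpenQuotientMap_mk.continuous)).mem_nhds hc)

/-- The orbit map has a smooth local section through every point, the translate of a slice. -/
theorem surjective_mfderiv_mk
    (hsmul : ∀ g : G, ContMDiff I' I' ∞ (fun s : S => g • s)) (s : S) :
    letI := chartedSpace σ hσ
    Function.Surjective (mfderiv I' 𝓘(ℝ, F) (OrbitSpace.mk G : S → OrbitSpace G S) s) := by
  let := chartedSpace σ hσ
  have := isManifold_chartedSpace σ hσ hsmul
  let c := σ (Quotient.out (OrbitSpace.mk G s))
  have hc : OrbitSpace.mk G s ∈ c.chart.source := mem_chart_source F (OrbitSpace.mk G s)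
  obtain ⟨y, hy, hys⟩ := c.mem_chart_source_iff.1 hc
  obtain ⟨g, hg⟩ := mk_eq_mk.1 hys.symm
  have hcy : c.chart (OrbitSpace.mk G s) = y := by
    rw [← hys]; exact c.chart.right_inv hy
  let τ : OrbitSpace G S → S := fun q => g • c.sec (c.chart q)
  have hτs : τ (OrbitSpace.mk G s) = s := by simp only [τ, hcy, hg]
  have hchart : ContMDiffAt 𝓘(ℝ, F) 𝓘(ℝ, F) ∞ c.chart (OrbitSpace.mk G s) :=
    contMDiffAt_extChartAt (I := 𝓘(ℝ, F)) (x := OrbitSpace.mk G s)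
  have hτ : ContMDiffAt 𝓘(ℝ, F) I' ∞ τ (OrbitSpace.mk G s) := by
    refine (hsmul g).contMDiffAt.comp _ (ContMDiffAt.comp _ ?_ hchart)
    rw [hcy]
    exact c.contMDiffOn_sec.contMDiffAt (c.isOpen_V.mem_nhds hy)
  have hid : OrbitSpace.mk G ∘ τ =ᶠ[𝓝 (OrbitSpace.mk G s)] id := by
    filter_upwards [c.chart.open_source.mem_nhds hc] with q hq
    exact (mk_smul g _).trans (c.chart.left_inv hq)
  have hmk : MDifferentiableAt I' 𝓘(ℝ, F) (OrbitSpace.mk G : S → OrbitSpace G S) (τ (OrbitSpace.mk G s)) :=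
    (contMDiff_mk σ hσ hsmul).mdifferentiableAt (by simp)
  have hcomp := (hmk.hasMFDerivAt.comp _ (hτ.mdifferentiableAt (by simp)).hasMFDerivAt)
  have h1 := hasMFDerivAt_unique hcomp ((hasMFDerivAt_id (OrbitSpace.mk G s)).congr_of_eventuallyEq hid)
  rw [hτs] at h1
  exact fun w => ⟨mfderiv 𝓘(ℝ, F) I' τ (OrbitSpace.mk G s) w, congrArg (fun T : F →L[ℝ] F => T w) h1⟩

end OrbitSlice

/-! ### The quotient MDP -/

/-- The hypothesis of compact preimages gives Mathlib's notion of a proper action, because a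
manifold is locally compact and Hausdorff. -/
lemma properSMul_of_isCompact_preimage {G S : Type*} [TopologicalSpace G] [Group G]
    [TopologicalSpace S] [T2Space S] [WeaklyLocallyCompactSpace S] [MulAction G S]
    [ContinuousSMul G S]
    (hproper : ∀ K : Set (S × S), IsCompact K →
      IsCompact ((fun x : G × S => (x.1 • x.2, x.2)) ⁻¹' K)) : ProperSMul G S where
  isProperMap_smul_pair := isProperMap_iff_isCompact_preimage.2
    ⟨continuous_smul.prodMk continuous_snd, fun K hK => hproper K hK⟩

/-- Slices around all points, with parameters in a fixed space of dimension `dim S - dim G`. -/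
theorem exists_orbitSlices {m k : ℕ} {S G : Type*}
    [TopologicalSpace S] [ChartedSpace (EuclideanSpace ℝ (Fin m)) S] [IsManifold (𝓡 m) ∞ S]
    [TopologicalSpace G] [ChartedSpace (EuclideanSpace ℝ (Fin k)) G] [Group G]
    [LieGroup (𝓡 k) ∞ G] [MulAction G S] [ContMDiffSMul (𝓡 k) (𝓡 m) ∞ G S] [ProperSMul G S]
    (hfree : ∀ (g : G) (s : S), g • s = s → g = 1) :
    ∃ d : ℕ, (Nonempty S → d + k = m) ∧
      ∃ σ : S → OrbitSlice (𝓡 m) (EuclideanSpace ℝ (Fin d)) G S, ∀ s, s ∈ (σ s).U := by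
  rcases isEmpty_or_nonempty S with hS | ⟨⟨s₁⟩⟩
  · exact ⟨0, fun h => hS.elim h.some, fun s => hS.elim s, fun s => hS.elim s⟩
  · obtain ⟨L, hL, -⟩ := exists_injective_hasFDerivAt_orbitMap (I := 𝓡 k) (I' := 𝓡 m) hfree s₁
    have hkm : k ≤ m := by
      simpa using LinearMap.finrank_le_finrank_of_injective
        (f := (L : EuclideanSpace ℝ (Fin k) →ₗ[ℝ] EuclideanSpace ℝ (Fin m))) hL
    have hslice : ∀ s : S, ∃ σ : OrbitSlice (𝓡 m) (EuclideanSpace ℝ (Fin (m - k))) G S,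
        s ∈ σ.U := fun s => by
      obtain ⟨σ, y, hy, rfl⟩ := exists_orbitSlice (𝓡 k) (I' := 𝓡 m)
        (F := EuclideanSpace ℝ (Fin (m - k))) (by simpa using Nat.sub_add_cancel hkm) hfree s
      exact ⟨σ, σ.mapsTo_sec hy⟩
    choose σ hσ using hslice
    exact ⟨m - k, fun _ => Nat.sub_add_cancel hkm, σ, hσ⟩

theorem theorem3 {m n k : ℕ} {S A G : Type*}
    -- the state space
    [TopologicalSpace S] [ChartedSpace (EuclideanSpace ℝ (Fin m)) S] [IsManifold (𝓡 m) ∞ S]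
    [T2Space S] [SecondCountableTopology S] [MeasurableSpace S] [BorelSpace S]
    -- the action space
    [TopologicalSpace A] [ChartedSpace (EuclideanSpace ℝ (Fin n)) A] [IsManifold (𝓡 n) ∞ A]
    [T2Space A] [SecondCountableTopology A] [MeasurableSpace A] [BorelSpace A]
    -- the Lie group and its smooth actions on states and actions
    [TopologicalSpace G] [ChartedSpace (EuclideanSpace ℝ (Fin k)) G] [Group G]
    [LieGroup (𝓡 k) ∞ G] [T2Space G] [SecondCountableTopology G]
    [MulAction G S] [ContMDiffSMul (𝓡 k) (𝓡 m) ∞ G S]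
    [MulAction G A] [ContMDiffSMul (𝓡 k) (𝓡 n) ∞ G A]
    (M : ContinuousMDP m n S A) (hsymm : M.IsSymmetry G)
    -- the action on states is free and proper
    (hfree : ∀ (g : G) (s : S), g • s = s → g = 1)
    (hproper : ∀ K : Set (S × S), IsCompact K →
      IsCompact ((fun x : G × S => (x.1 • x.2, x.2)) ⁻¹' K))
    -- an arbitrary equivariant map
    (lam : S → G) (hlam : ∀ (g : G) (s : S), lam (g • s) = g * lam s) :
    -- the orbit space, with the quotient topology, is a smooth manifold of dimension
    -- `dim S - dim G` for which the orbit map is a smooth submersion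
    ∃ (d : ℕ) (_ : ChartedSpace (EuclideanSpace ℝ (Fin d)) (OrbitSpace G S))
      (_ : IsManifold (𝓡 d) ∞ (OrbitSpace G S)) (_ : T2Space (OrbitSpace G S))
      (_ : SecondCountableTopology (OrbitSpace G S)),
      (Nonempty S → d + k = m) ∧
      ContMDiff (𝓡 m) (𝓡 d) ∞ (OrbitSpace.mk G : S → OrbitSpace G S) ∧
      (∀ s : S, Function.Surjective
        (mfderiv (𝓡 m) (𝓡 d) (OrbitSpace.mk G : S → OrbitSpace G S) s)) ∧
      -- the quotient MDP, given by the same formulas for every orbit representative `s`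
      ∃ M' : ContinuousMDP d n (OrbitSpace G S) A,
        M'.discount = M.discount ∧
        (∀ (s' : OrbitSpace G S) (a' : A) (s : S), OrbitSpace.mk G s = s' →
          M'.reward (s', a') = M.reward (s, lam s • a')) ∧
        (∀ (s' : OrbitSpace G S) (a' : A) (B' : Set (OrbitSpace G S)), MeasurableSet B' →
          ∀ s : S, OrbitSpace.mk G s = s' →
            (M'.transition (s', a') : Measure (OrbitSpace G S)) B' =
              (M.transition (s, lam s • a') : Measure S) (OrbitSpace.mk G ⁻¹' B')) ∧
        -- the homomorphism
        M.IsHom M' (OrbitSpace.mk G) (fun x => (lam x.1)⁻¹ • x.2) ∧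
        -- policy lifting
        ∀ π' : MDPPolicy (OrbitSpace G S) A, ∃ π : MDPPolicy S A,
          (∀ (s : S) (A₀ : Set A), MeasurableSet A₀ →
            (π s : Measure A) A₀ =
              (π' (OrbitSpace.mk G s) : Measure A) ((fun a => (lam s)⁻¹ • a) '' A₀)) ∧
          IsPolicyLift (OrbitSpace.mk G) (fun x => (lam x.1)⁻¹ • x.2) π' π := by
  have : ContinuousSMul G S :=
    ⟨(contMDiff_smul (I := 𝓡 k) (I' := 𝓡 m) (n := ∞) (G := G) (M := S)).continuous⟩
  have : LocallyCompactSpace S := ChartedSpace.locallyCompactSpace (EuclideanSpace ℝ (Fin m)) S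
  have : ProperSMul G S := properSMul_of_isCompact_preimage hproper
  have htrans : ∀ g : G, ContMDiff (𝓡 m) (𝓡 m) ∞ (fun s : S => g • s) :=
    contMDiff_translation (𝓡 m) (𝓡 k)
  have hactA : ∀ g : G, Measurable (fun a : A => g • a) := fun g =>
    (contMDiff_translation (𝓡 n) (𝓡 k) g).continuous.measurable
  have hmk : Measurable (OrbitSpace.mk G : S → OrbitSpace G S) :=
    OrbitSpace.isOpenQuotientMap_mk.continuous.measurable
  obtain ⟨d, hd, σ, hσ⟩ := exists_orbitSlices (m := m) (k := k) hfree
  let ics : ChartedSpace (EuclideanSpace ℝ (Fin d)) (OrbitSpace G S) :=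
    OrbitSlice.chartedSpace σ hσ
  have imf : IsManifold (𝓡 d) ∞ (OrbitSpace G S) :=
    OrbitSlice.isManifold_chartedSpace σ hσ htrans
  have it2 : T2Space (OrbitSpace G S) := t2Space_quotient_mulAction_of_properSMul
  have isc : SecondCountableTopology (OrbitSpace G S) :=
    ContinuousConstSMul.secondCountableTopology
  refine ⟨d, ics, imf, it2, isc, hd, OrbitSlice.contMDiff_mk σ hσ htrans,
    OrbitSlice.surjective_mfderiv_mk σ hσ htrans, ?_⟩
  -- Two representatives `g • s` and `s` of an orbit give the pairs `(g • s, g • lam s • a')` and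
  -- `(s, lam s • a')`, which the symmetry identifies.
  have hrep : ∀ (s t : S) (a' : A), OrbitSpace.mk G s = OrbitSpace.mk G t →
      ∃ g : G, (s, lam s • a') = (g • t, g • lam t • a') := fun s t a' h => by
    obtain ⟨g, rfl⟩ := OrbitSpace.mk_eq_mk.1 h
    exact ⟨g, by rw [hlam, mul_smul]⟩
  have hout : ∀ q : OrbitSpace G S, OrbitSpace.mk G (Quotient.out q) = q := Quotient.out_eq
  let M' : ContinuousMDP d n (OrbitSpace G S) A :=
    { reward := fun x => M.reward (Quotient.out x.1, lam (Quotient.out x.1) • x.2)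
      transition := fun x =>
        (M.transition (Quotient.out x.1, lam (Quotient.out x.1) • x.2)).map hmk.aemeasurable
      discount := M.discount
      discount_nonneg := M.discount_nonneg
      discount_lt_one := M.discount_lt_one }
  have hR : ∀ (s' : OrbitSpace G S) (a' : A) (s : S), OrbitSpace.mk G s = s' →
      M'.reward (s', a') = M.reward (s, lam s • a') := fun s' a' s hs => by
    obtain ⟨g, hg⟩ := hrep s (Quotient.out s') a' (hs.trans (hout s').symm)
    rw [hg]
    exact hsymm.reward_eq g _ _
  have hτ : ∀ (s' : OrbitSpace G S) (a' : A) (B' : Set (OrbitSpace G S)), MeasurableSet B' →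
      ∀ s : S, OrbitSpace.mk G s = s' →
        (M'.transition (s', a') : Measure (OrbitSpace G S)) B' =
          (M.transition (s, lam s • a') : Measure S) (OrbitSpace.mk G ⁻¹' B') :=
    fun s' a' B' hB' s hs => by
      obtain ⟨g, hg⟩ := hrep s (Quotient.out s') a' (hs.trans (hout s').symm)
      rw [hg]
      refine (Measure.map_apply hmk hB').trans
        (hsymm.transition_eq _ (hmk hB') (fun h t => ?_) g _ _)
      rw [Set.mem_preimage, Set.mem_preimage, OrbitSpace.mk_smul]
  refine ⟨M', rfl, hR, hτ, ?_, fun π' => ?_⟩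
  · exact
      { discount_eq := rfl
        measurable_state := hmk
        surjective_state := OrbitSpace.mk_surjective
        measurable_action := fun s => hactA (lam s)⁻¹
        surjective_action := fun s => MulAction.surjective (lam s)⁻¹
        reward_eq := fun s a => by rw [hR _ _ s rfl, smul_inv_smul]
        transition_eq := fun s a B' hB' => by rw [hτ _ _ B' hB' s rfl, smul_inv_smul] }
  · refine ⟨fun s => (π' (OrbitSpace.mk G s)).map (hactA (lam s)).aemeasurable,
      fun s A₀ hA₀ => ?_, fun s A₀ hA₀ => ?_⟩
    · refine (Measure.map_apply (hactA (lam s)) hA₀).trans (congrArg _ ?_)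
      exact Set.preimage_smul (lam s) A₀
    · refine (Measure.map_apply (hactA (lam s)) (hactA (lam s)⁻¹ hA₀)).trans (congrArg _ ?_)
      ext a
      simp
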